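/- Let $d \ge 0$ and $1 \le k \le d+1$, and let $M$ be a combinatorial (PL) $d$-manifold, possibly with boundary: a $d$-dimensional simplicial complex, not necessarily finite or connected, in which the link of every vertex is a combinatorial $(d-1)$-sphere or $(d-1)$-disk. Color the vertices of $M$ by any set of colors, and give every point $x$ of the geometric realization $|M|$ the colors of its closest vertices, i.e. of the vertices with the largest barycentric coordinate at $x$. For a set $\mathcal C$ of $k$ colors, the $k$-color class of $\mathcal C$ is the set of points of $|M|$ that have all the colors in $\mathcal C$ (and possibly others). A triangulated $n$-manifold is called orientable if its $n$-simplices can be oriented so that any two distinct $n$-simplices with a common $(n-1)$-face induce opposite orientations on it (for $n=0$ this is no condition). **Proposition (label orientation).** If $M$ is orientable, then every connected component $N$ of a $k$-color class of $M$ is orientable. Precisely: $N$ is the union of the simplices of the barycentric subdivision of $M$ that are contained in $N$, these simplices form a pure simplicial complex of dimension $d-k+1$, and the $(d-k+1)$-simplices of this complex can be oriented so that any two distinct ones with a common $(d-k)$-face induce opposite orientations on it. -/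

import Mathlib

namespace PreAbstractSimplicialComplex

variable {V W : Type*}

/-- The geometric realization `|K|`, in barycentric coordinates: the functions `V → ℝ` that are
nonnegative, supported on a face, and have total sum `1`. It carries the subspace topology of the
topology of coordinatewise convergence, which is the usual topology of `|K|` for every locally
finite complex, in particular for every combinatorial manifold. -/
def realization (K : PreAbstractSimplicialComplex V) : Set (V → ℝ) :=
  {x | (∀ v, 0 ≤ x v) ∧ ∃ σ ∈ K.faces, (∀ v, v ∉ σ → x v = 0) ∧ ∑ v ∈ σ, x v = 1}

/-- The link of a vertex `v`: the nonempty faces `τ` with `v ∉ τ` and `{v} ∪ τ ∈ K`. -/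
def link (K : PreAbstractSimplicialComplex V) (v : V) : PreAbstractSimplicialComplex V where
  faces := {τ | τ.Nonempty ∧ ∃ h : v ∉ τ, τ.cons v h ∈ K.faces}
  isRelLowerSet_faces := by
    rintro τ ⟨hne, hv, hτ⟩
    refine ⟨hne, fun ρ hρ hρne => ⟨hρne, fun h => hv (hρ h), ?_⟩⟩
    exact (K.isRelLowerSet_faces hτ).2 (Finset.cons_subset_cons.2 hρ) (Finset.cons_nonempty _)

/-- The full simplex with `m` vertices, of dimension `m - 1`. -/
def fullSimplex (m : ℕ) : PreAbstractSimplicialComplex (Fin m) where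
  faces := {σ | σ.Nonempty}
  isRelLowerSet_faces := fun _ h => ⟨h, fun _ _ h' => h'⟩

/-- The boundary of the simplex with `m` vertices, a sphere of dimension `m - 2`. -/
def simplexBoundary (m : ℕ) : PreAbstractSimplicialComplex (Fin m) where
  faces := {σ | σ.Nonempty ∧ σ ≠ Finset.univ}
  isRelLowerSet_faces := by
    rintro σ ⟨h, hσ⟩
    refine ⟨h, fun τ hτ h' => ⟨h', ?_⟩⟩
    rintro rfl
    exact hσ (Finset.univ_subset_iff.1 hτ)

/-- `f` is piecewise linear on the compact set `S`: it is continuous on `S`, and `S` is a finite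
union of convex polytopes on each of which `f` is affine. -/
def IsPLOn (f : (V → ℝ) → (W → ℝ)) (S : Set (V → ℝ)) : Prop :=
  ContinuousOn f S ∧ ∃ P : Finset (Finset (V → ℝ)),
    (⋃ t ∈ P, convexHull ℝ (t : Set (V → ℝ))) = S ∧
    ∀ t ∈ P, ∃ A : (V → ℝ) →ᵃ[ℝ] (W → ℝ), Set.EqOn f A (convexHull ℝ (t : Set (V → ℝ)))

/-- Two (finite) complexes are PL-homeomorphic: there is a piecewise linear bijection between
their realizations. Such a bijection maps polytopes on which it is affine to polytopes, so its
inverse is piecewise linear, too. -/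
def PLHomeomorphic (K : PreAbstractSimplicialComplex V) (L : PreAbstractSimplicialComplex W) :
    Prop :=
  ∃ f : (V → ℝ) → (W → ℝ), Set.BijOn f K.realization L.realization ∧ IsPLOn f K.realization

/-- `K` is a combinatorial (PL) manifold of dimension `d` without boundary: the link of every
vertex is a combinatorial `(d - 1)`-sphere, that is, a combinatorial manifold PL-homeomorphic to
the boundary of a `d`-simplex. A complex of dimension `0` is always a manifold. -/
def IsClosedCombinatorialManifold : ℕ → PreAbstractSimplicialComplex V → Prop
  | 0, K => ∀ σ ∈ K.faces, σ.card = 1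
  | d + 1, K => ∀ v, {v} ∈ K.faces →
      IsClosedCombinatorialManifold d (K.link v) ∧
        PLHomeomorphic (K.link v) (simplexBoundary (d + 2))

/-- `K` is a combinatorial (PL) manifold of dimension `d`, possibly with boundary: the link of
every vertex is a combinatorial `(d - 1)`-sphere, or a combinatorial `(d - 1)`-disk, that is, a
combinatorial manifold with boundary that is PL-homeomorphic to a `(d - 1)`-simplex. -/
def IsCombinatorialManifold : ℕ → PreAbstractSimplicialComplex V → Prop
  | 0, K => ∀ σ ∈ K.faces, σ.card = 1
  | d + 1, K => ∀ v, {v} ∈ K.faces →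
      (IsClosedCombinatorialManifold d (K.link v) ∧
        PLHomeomorphic (K.link v) (simplexBoundary (d + 2))) ∨
      (IsCombinatorialManifold d (K.link v) ∧
        PLHomeomorphic (K.link v) (fullSimplex (d + 1)))

/-- `K` is pure of dimension `n`: every face lies in a face with `n + 1` vertices, and no face has
more vertices. -/
def IsPure (n : ℕ) (K : PreAbstractSimplicialComplex V) : Prop :=
  ∀ σ ∈ K.faces, σ.card ≤ n + 1 ∧ ∃ τ ∈ K.faces, σ ⊆ τ ∧ τ.card = n + 1

/-- `o` assigns to every ordered `n`-simplex `v = (v₀, …, vₙ)` of `K` a sign which depends on the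
order by the sign of the permutation (so it is an orientation of every `n`-simplex), and any two
distinct `n`-simplices with a common `(n - 1)`-face induce opposite orientations on it: if
`v` and `w` differ precisely in the vertex at one place `i`, they have opposite signs. There is no
such condition for `n = 0`, where the common face would be empty. -/
def IsCoherentOrientation (n : ℕ) (K : PreAbstractSimplicialComplex V)
    (o : (Fin (n + 1) ↪ V) → ℤˣ) : Prop :=
  (∀ v : Fin (n + 1) ↪ V, Finset.univ.map v ∈ K.faces → ∀ π : Equiv.Perm (Fin (n + 1)),
    o (π.toEmbedding.trans v) = Equiv.Perm.sign π * o v) ∧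
  (0 < n → ∀ v w : Fin (n + 1) ↪ V, Finset.univ.map v ∈ K.faces → Finset.univ.map w ∈ K.faces →
    ∀ i, v i ≠ w i → (∀ j, j ≠ i → v j = w j) → o w = - o v)

/-- An `n`-dimensional complex is orientable if its `n`-simplices can be oriented coherently. -/
def IsOrientable (n : ℕ) (K : PreAbstractSimplicialComplex V) : Prop :=
  ∃ o : (Fin (n + 1) ↪ V) → ℤˣ, IsCoherentOrientation n K o

/-- The barycenter of the simplex spanned by `σ`, in barycentric coordinates. -/
noncomputable def barycenter (σ : Finset V) : V → ℝ :=
  Set.indicator (σ : Set V) (fun _ => (σ.card : ℝ)⁻¹)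

/-- The barycentric subdivision: its vertices are the faces of `K` (standing for their
barycenters), and its faces are the nonempty finite chains of faces of `K`. -/
def barycentricSubdivision (K : PreAbstractSimplicialComplex V) :
    PreAbstractSimplicialComplex (Finset V) where
  faces := {s | s.Nonempty ∧ (∀ σ ∈ s, σ ∈ K.faces) ∧ IsChain (· ⊆ ·) (s : Set (Finset V))}
  isRelLowerSet_faces := by
    rintro s ⟨h, hK, hc⟩
    exact ⟨h, fun t ht h' => ⟨h', fun σ hσ => hK σ (ht hσ), hc.mono (Finset.coe_subset.2 ht)⟩⟩

/-- The closed geometric simplex in `|K|` of a simplex `s` of the barycentric subdivision. -/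
def geometricSimplex (s : Finset (Finset V)) : Set (V → ℝ) :=
  convexHull ℝ (barycenter '' (s : Set (Finset V)))

/-- The subcomplex of the barycentric subdivision of `K` which consists of the simplices that are
contained in the set `N ⊆ |K|`. -/
def subdivisionIn (K : PreAbstractSimplicialComplex V) (N : Set (V → ℝ)) :
    PreAbstractSimplicialComplex (Finset V) where
  faces := {s | s ∈ K.barycentricSubdivision.faces ∧ geometricSimplex s ⊆ N}
  isRelLowerSet_faces := by
    rintro s ⟨hs, hN⟩
    refine ⟨(K.barycentricSubdivision.isRelLowerSet_faces hs).1, fun t ht h' =>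
      ⟨(K.barycentricSubdivision.isRelLowerSet_faces hs).2 ht h', ?_⟩⟩
    exact (convexHull_mono (Set.image_mono (Finset.coe_subset.2 ht))).trans hN

/-- The Voronoi coloring: a point gets the colors of its closest vertices, which are those with
maximal barycentric coordinate. -/
def voronoiColoring {ι : Type*} (c : V → ι) (x : V → ℝ) : Set ι :=
  c '' {v | ∀ w, x w ≤ x v}

/-- The color class of a set `C` of colors: the points of `|K|` that have all the colors in `C`
(and possibly others). -/
def colorClass {ι : Type*} (K : PreAbstractSimplicialComplex V) (c : V → ι) (C : Finset ι) :
    Set (V → ℝ) :=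
  {x | x ∈ K.realization ∧ (C : Set ι) ⊆ voronoiColoring c x}

end PreAbstractSimplicialComplex

namespace PreAbstractSimplicialComplex

variable {V W ι : Type*}

/-! ### Purity of combinatorial manifolds -/

/-! A simplex of the barycentric subdivision is a chain of faces, and it lies in the color class of
`C` exactly when every member of the chain has vertices of all colors in `C`
(`geometricSimplex_subset_colorClass_iff`). Such simplices cover the class, and each is connected,
so they cover each component. The manifold hypothesis is used only through purity: with it, a chain
in the class extends to one with members of every size from `k` to `d + 1`, whose bottom has one
vertex of each color.

For the orientation (`IsOrientable.chains`), order the bottom by color and append the vertices in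
the order in which the chain adds them. This gives an ordered facet of `M`, hence a sign. Let two
such chains differ in one member. If it is neither bottom nor top, two consecutive vertices are
transposed. If it is the bottom, the first appended vertex trades places with the bottom vertex of
its color. If it is the top, the last vertex is replaced, and the two facets of `M` are adjacent.
The sign changes each time: in the first two cases by a transposition, in the third by orientability
of `M`. -/

theorem simplexBoundary_realization_nonempty (d : ℕ) :
    (simplexBoundary (d + 2)).realization.Nonempty := by
  refine ⟨Pi.single 0 1, fun v => ?_, {0}, ⟨by simp, fun h => ?_⟩, fun v hv => ?_, by simp⟩
  · by_cases h : v = 0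
    · subst h; simp
    · simp [h]
  · have := congrArg Finset.card h
    simp at this
  · simp_all

theorem fullSimplex_realization_nonempty (d : ℕ) :
    (fullSimplex (d + 1)).realization.Nonempty := by
  refine ⟨Pi.single 0 1, fun v => ?_, {0}, by simp [fullSimplex], fun v hv => ?_, by simp⟩
  · by_cases h : v = 0
    · subst h; simp
    · simp [h]
  · simp_all

theorem PLHomeomorphic.faces_nonempty {K : PreAbstractSimplicialComplex V}
    {L : PreAbstractSimplicialComplex W} (h : K.PLHomeomorphic L) (hL : L.realization.Nonempty) :
    K.faces.Nonempty := by
  obtain ⟨f, hf, -⟩ := h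
  obtain ⟨y, hy⟩ := hL
  obtain ⟨x, ⟨-, σ, hσ, -⟩, -⟩ := hf.surjOn hy
  exact ⟨σ, hσ⟩

theorem isPure_zero {K : PreAbstractSimplicialComplex V} (h : ∀ σ ∈ K.faces, σ.card = 1) :
    K.IsPure 0 :=
  fun σ hσ => ⟨(h σ hσ).le, σ, hσ, subset_rfl, h σ hσ⟩

/-- A facet containing `σ` is a cone from `v ∈ σ` over a facet of the link. The link must be
nonempty for the case `σ = {v}`, where `σ.erase v` is not a face. -/
theorem isPure_succ_of_link {d : ℕ} {K : PreAbstractSimplicialComplex V}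
    (h : ∀ v, {v} ∈ K.faces → (K.link v).IsPure d ∧ (K.link v).faces.Nonempty) :
    K.IsPure (d + 1) := by
  classical
  intro σ hσ
  obtain ⟨v, hv⟩ := (K.isRelLowerSet_faces hσ).1
  obtain ⟨hp, ρ, hρ⟩ := h v ((K.isRelLowerSet_faces hσ).2 (by simpa using hv) (by simp))
  have hσv : insert v (σ.erase v) = σ := Finset.insert_erase hv
  have hcard := Finset.card_erase_add_one hv
  obtain ⟨hle, τ, ⟨-, hvτ, hτ⟩, hsub, hτc⟩ :
      (σ.erase v).card ≤ d + 1 ∧ ∃ τ ∈ (K.link v).faces, σ.erase v ⊆ τ ∧ τ.card = d + 1 := by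
    rcases (σ.erase v).eq_empty_or_nonempty with he | he
    · obtain ⟨-, τ, hτ, -, hτc⟩ := hp ρ hρ
      exact ⟨by simp [he], τ, hτ, by simp [he], hτc⟩
    · refine hp _ ⟨he, Finset.notMem_erase v σ, ?_⟩
      rwa [Finset.cons_eq_insert, hσv]
  refine ⟨by omega, τ.cons v hvτ, hτ, ?_, by rw [Finset.card_cons, hτc]⟩
  rw [← hσv, Finset.cons_eq_insert]
  exact Finset.insert_subset_insert _ hsub

theorem IsClosedCombinatorialManifold.isPure {d : ℕ} {K : PreAbstractSimplicialComplex V}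
    (h : K.IsClosedCombinatorialManifold d) : K.IsPure d := by
  induction d generalizing K with
  | zero => exact isPure_zero h
  | succ d ih =>
    exact isPure_succ_of_link fun v hv => ⟨ih (h v hv).1,
      (h v hv).2.faces_nonempty (simplexBoundary_realization_nonempty d)⟩

theorem IsCombinatorialManifold.isPure {d : ℕ} {K : PreAbstractSimplicialComplex V}
    (h : K.IsCombinatorialManifold d) : K.IsPure d := by
  induction d generalizing K with
  | zero => exact isPure_zero h
  | succ d ih =>
    refine isPure_succ_of_link fun v hv => ?_
    rcases h v hv with ⟨h₁, h₂⟩ | ⟨h₁, h₂⟩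
    · exact ⟨h₁.isPure, h₂.faces_nonempty (simplexBoundary_realization_nonempty d)⟩
    · exact ⟨ih h₁, h₂.faces_nonempty (fullSimplex_realization_nonempty d)⟩

/-! ### Chains of finite sets -/

theorem exists_subset_of_isChain {s : Finset (Finset V)} (hs : s.Nonempty)
    (hc : IsChain (· ⊆ ·) (s : Set (Finset V))) : ∃ τ ∈ s, ∀ σ ∈ s, τ ⊆ σ := by
  obtain ⟨τ, hτ, hmin⟩ := s.exists_min_image Finset.card hs
  refine ⟨τ, hτ, fun σ hσ => ?_⟩
  rcases hc.total hτ hσ with h | h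
  · exact h
  · exact (Finset.eq_of_subset_of_card_le h (hmin σ hσ)).ge

theorem exists_superset_of_isChain {s : Finset (Finset V)} (hs : s.Nonempty)
    (hc : IsChain (· ⊆ ·) (s : Set (Finset V))) : ∃ τ ∈ s, ∀ σ ∈ s, σ ⊆ τ := by
  obtain ⟨τ, hτ, hmax⟩ := s.exists_max_image Finset.card hs
  refine ⟨τ, hτ, fun σ hσ => ?_⟩
  rcases hc.total hτ hσ with h | h
  · exact (Finset.eq_of_subset_of_card_le h (hmax σ hσ)).ge
  · exact h

theorem injOn_card_of_isChain {s : Set (Finset V)} (hc : IsChain (· ⊆ ·) s) :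
    Set.InjOn Finset.card s := by
  intro σ hσ τ hτ h
  rcases hc.total hσ hτ with h' | h'
  · exact Finset.eq_of_subset_of_card_le h' h.ge
  · exact (Finset.eq_of_subset_of_card_le h' h.le).symm

theorem exists_maximal_chain_between {ρ τ : Finset V} (hρτ : ρ ⊆ τ) {s : Finset (Finset V)}
    (hc : IsChain (· ⊆ ·) (s : Set (Finset V))) (hs : ∀ σ ∈ s, ρ ⊆ σ ∧ σ ⊆ τ) :
    ∃ t : Finset (Finset V), s ⊆ t ∧ IsChain (· ⊆ ·) (t : Set (Finset V)) ∧
      (∀ σ ∈ t, ρ ⊆ σ ∧ σ ⊆ τ) ∧ t.card + ρ.card = τ.card + 1 := by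
  classical
  induction τ using Finset.strongInduction generalizing s with
  | H τ ih =>
    by_cases h : ρ = τ
    · subst h
      refine ⟨{ρ}, fun σ hσ => ?_, by simp, by simp, by simp [add_comm]⟩
      simpa using (hs σ hσ).2.antisymm (hs σ hσ).1
    · have hss : ∀ σ ∈ insert ρ (s.erase τ), ρ ⊆ σ ∧ σ ⊂ τ := by
        intro σ hσ
        rcases Finset.mem_insert.1 hσ with rfl | hσ
        · exact ⟨subset_rfl, hρτ.ssubset_of_ne h⟩
        · rw [Finset.mem_erase] at hσ
          exact ⟨(hs σ hσ.2).1, (hs σ hσ.2).2.ssubset_of_ne hσ.1⟩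
      -- With `ρ` inserted, the chain below `τ` has a largest member `μ`; a vertex of `τ` outside
      -- `μ` can be removed from `τ` without losing any member.
      have hc' : IsChain (· ⊆ ·) ((insert ρ (s.erase τ) : Finset _) : Set (Finset V)) := by
        rw [Finset.coe_insert]
        refine (hc.mono (Finset.coe_subset.2 (s.erase_subset τ))).insert fun σ hσ _ => Or.inl ?_
        exact (hs σ (Finset.mem_of_mem_erase hσ)).1
      obtain ⟨μ, hμ, hmax⟩ := exists_superset_of_isChain ⟨ρ, Finset.mem_insert_self _ _⟩ hc'
      obtain ⟨v, hvτ, hvμ⟩ := Finset.exists_of_ssubset (hss μ hμ).2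
      have hsub : ∀ σ ∈ insert ρ (s.erase τ), σ ⊆ τ.erase v := fun σ hσ =>
        Finset.subset_erase.2 ⟨(hss σ hσ).2.subset, fun hv => hvμ (hmax σ hσ hv)⟩
      obtain ⟨t, hst, htc, ht, hcard⟩ := ih (τ.erase v) (Finset.erase_ssubset hvτ)
        (hsub ρ (Finset.mem_insert_self _ _)) hc' fun σ hσ => ⟨(hss σ hσ).1, hsub σ hσ⟩
      have hτt : τ ∉ t := fun hτ => Finset.notMem_erase v τ ((ht τ hτ).2 hvτ)
      refine ⟨insert τ t, fun σ hσ => ?_, ?_, fun σ hσ => ?_, ?_⟩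
      · by_cases hστ : σ = τ
        · simp [hστ]
        · exact Finset.mem_insert_of_mem (hst (by simp [hσ, hστ]))
      · rw [Finset.coe_insert]
        exact htc.insert fun σ hσ _ => Or.inr ((ht σ hσ).2.trans (Finset.erase_subset v τ))
      · rcases Finset.mem_insert.1 hσ with rfl | hσ
        · exact ⟨hρτ, subset_rfl⟩
        · exact ⟨(ht σ hσ).1, (ht σ hσ).2.trans (Finset.erase_subset v τ)⟩
      · rw [Finset.card_insert_of_notMem hτt]
        have := Finset.card_erase_add_one hvτ
        omega

/-! ### The color class as a subcomplex of the barycentric subdivision -/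

theorem barycenter_apply_le (σ : Finset V) {v : V} (hv : v ∈ σ) (w : V) :
    barycenter σ w ≤ barycenter σ v := by
  classical
  simp only [barycenter, Set.indicator_apply, Finset.mem_coe, hv, if_true]
  split_ifs
  · exact le_rfl
  · positivity

theorem mem_of_forall_barycenter_le {σ : Finset V} (hσ : σ.Nonempty) {v : V}
    (h : ∀ w, barycenter σ w ≤ barycenter σ v) : v ∈ σ := by
  classical
  by_contra hv
  obtain ⟨w, hw⟩ := hσ
  have := h w
  simp only [barycenter, Set.indicator_apply, Finset.mem_coe, hv, hw, if_true, if_false] at this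
  have hpos : 0 < σ.card := Finset.card_pos.2 ⟨w, hw⟩
  have : (0 : ℝ) < (σ.card : ℝ)⁻¹ := by positivity
  linarith

theorem barycenter_mem_geometricSimplex {s : Finset (Finset V)} {σ : Finset V} (hσ : σ ∈ s) :
    barycenter σ ∈ geometricSimplex s :=
  subset_convexHull ℝ _ ⟨σ, hσ, rfl⟩

theorem geometricSimplex_mono {s t : Finset (Finset V)} (h : s ⊆ t) :
    geometricSimplex s ⊆ geometricSimplex t :=
  convexHull_mono (Set.image_mono (Finset.coe_subset.2 h))

theorem geometricSimplex_subset_realization {K : PreAbstractSimplicialComplex V}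
    {s : Finset (Finset V)} (hs : s ∈ K.barycentricSubdivision.faces) :
    geometricSimplex s ⊆ K.realization := by
  classical
  obtain ⟨hne, hK, hc⟩ := hs
  obtain ⟨τ, hτ, hmax⟩ := exists_superset_of_isChain hne hc
  have hsub : geometricSimplex s ⊆
      {x : V → ℝ | (∀ v, 0 ≤ x v) ∧ (∀ v, v ∉ τ → x v = 0) ∧ ∑ v ∈ τ, x v = 1} := by
    refine convexHull_min ?_ ?_
    · rintro _ ⟨σ, hσ, rfl⟩
      have hne : σ.card ≠ 0 := Finset.card_ne_zero.2 (K.isRelLowerSet_faces (hK σ hσ)).1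
      refine ⟨fun v => Set.indicator_nonneg (fun _ _ => by positivity) v, fun v hv => ?_, ?_⟩
      · exact Set.indicator_of_notMem (fun h => hv (hmax σ hσ h)) _
      · simp only [barycenter, Set.indicator_apply, Finset.mem_coe]
        rw [← Finset.sum_filter, Finset.filter_mem_eq_inter,
          Finset.inter_eq_right.2 (hmax σ hσ)]
        simp [hne]
    · rintro x ⟨hx, hx', hx''⟩ y ⟨hy, hy', hy''⟩ a b ha hb hab
      refine ⟨fun v => ?_, fun v hv => ?_, ?_⟩
      · have := mul_nonneg ha (hx v)
        have := mul_nonneg hb (hy v)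
        simp only [Pi.add_apply, Pi.smul_apply, smul_eq_mul]
        linarith
      · simp [hx' v hv, hy' v hv]
      · simp [Finset.sum_add_distrib, ← Finset.mul_sum, hx'', hy'', hab]
  intro x hx
  obtain ⟨h₁, h₂⟩ := hsub hx
  exact ⟨h₁, τ, hK τ hτ, h₂⟩

/-- The closest vertices at a barycenter are those of its face. Conversely, the vertices of the
smallest face are closest at every barycenter of the chain; this condition is convex, so it holds on
the whole simplex. -/
theorem geometricSimplex_subset_colorClass_iff {K : PreAbstractSimplicialComplex V} {c : V → ι}
    {C : Finset ι} {s : Finset (Finset V)} (hs : s ∈ K.barycentricSubdivision.faces) :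
    geometricSimplex s ⊆ K.colorClass c C ↔ ∀ σ ∈ s, (C : Set ι) ⊆ c '' σ := by
  constructor
  · intro h σ hσ
    refine (h (barycenter_mem_geometricSimplex hσ)).2.trans (Set.image_mono fun v hv => ?_)
    exact mem_of_forall_barycenter_le (K.isRelLowerSet_faces (hs.2.1 σ hσ)).1 hv
  · intro h x hx
    refine ⟨geometricSimplex_subset_realization hs hx, ?_⟩
    obtain ⟨τ, hτ, hmin⟩ := exists_subset_of_isChain hs.1 hs.2.2
    have hsub : geometricSimplex s ⊆ {x : V → ℝ | ∀ v ∈ τ, ∀ w, x w ≤ x v} := by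
      refine convexHull_min ?_ ?_
      · rintro _ ⟨σ, hσ, rfl⟩ v hv w
        exact barycenter_apply_le σ (hmin σ hσ hv) w
      · intro x hx y hy a b ha hb _ v hv w
        have := mul_le_mul_of_nonneg_left (hx v hv w) ha
        have := mul_le_mul_of_nonneg_left (hy v hv w) hb
        simp only [Pi.add_apply, Pi.smul_apply, smul_eq_mul]
        linarith
    exact (h τ hτ).trans (Set.image_mono fun v hv => hsub hx v hv)

/-- Every point of a simplex lies in a simplex of its barycentric subdivision all of whose vertices
are barycenters of faces that contain the vertices closest to the point. -/
theorem exists_chain_mem_geometricSimplex (σ : Finset V) (x : V → ℝ) (hx : ∀ v, 0 ≤ x v)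
    (hσ : ∀ v, v ∉ σ → x v = 0) (hsum : ∑ v ∈ σ, x v = 1) :
    ∃ s : Finset (Finset V), s.Nonempty ∧ IsChain (· ⊆ ·) (s : Set (Finset V)) ∧
      (∀ τ ∈ s, τ.Nonempty ∧ τ ⊆ σ ∧ ∀ v, (∀ w, x w ≤ x v) → v ∈ τ) ∧
      x ∈ geometricSimplex s := by
  classical
  induction σ using Finset.strongInduction generalizing x with
  | H σ ih =>
    have hne : σ.Nonempty := by
      rw [Finset.nonempty_iff_ne_empty]
      rintro rfl
      simp at hsum
    have hmax : ∀ v, (∀ w, x w ≤ x v) → v ∈ σ := by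
      intro v hv
      by_contra hvσ
      have : ∑ v ∈ σ, x v ≤ 0 := Finset.sum_nonpos fun w _ => (hv w).trans (hσ v hvσ).le
      linarith
    have hpos : (0 : ℝ) < σ.card := by exact_mod_cast hne.card_pos
    obtain ⟨u, hu, hmin⟩ := σ.exists_min_image x hne
    have hle : σ.card * x u ≤ 1 := by
      rw [← hsum, ← nsmul_eq_mul]
      exact Finset.card_nsmul_le_sum σ x (x u) hmin
    rcases hle.eq_or_lt with heq | hlt
    · have hall : ∀ v ∈ σ, x u = x v := by
        refine (Finset.sum_eq_sum_iff_of_le hmin).1 ?_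
        rw [hsum, Finset.sum_const, nsmul_eq_mul, heq]
      have hxb : x = barycenter σ := by
        ext v
        by_cases hv : v ∈ σ
        · rw [barycenter, Set.indicator_of_mem (Finset.mem_coe.2 hv), ← hall v hv]
          field_simp
          linarith
        · rw [barycenter, Set.indicator_of_notMem (by simpa using hv), hσ v hv]
      refine ⟨{σ}, by simp, by simp, ?_, ?_⟩
      · intro τ hτ
        rw [Finset.mem_singleton] at hτ
        subst hτ
        exact ⟨hne, subset_rfl, hmax⟩
      · rw [hxb]
        exact barycenter_mem_geometricSimplex (by simp)
    -- Write `x = l • barycenter σ + (1 - l) • y`, with `l` as large as possible: then `y` vanishes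
    -- at `u`, where `x` is least on `σ`, and induction applies to `σ.erase u`.
    · set l : ℝ := σ.card * x u with hl
      have hl1 : 0 < 1 - l := by linarith
      let y : V → ℝ := fun v => if v ∈ σ then (x v - x u) / (1 - l) else 0
      have hy : ∀ v ∈ σ, y v = (x v - x u) / (1 - l) := fun v hv => if_pos hv
      have hy' : ∀ v ∉ σ, y v = 0 := fun v hv => if_neg hv
      have hy0 : ∀ v, 0 ≤ y v := by
        intro v
        by_cases hv : v ∈ σ
        · rw [hy v hv]
          exact div_nonneg (sub_nonneg.2 (hmin v hv)) hl1.le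
        · exact (hy' v hv).ge
      have hyu : y u = 0 := by rw [hy u hu, sub_self, zero_div]
      obtain ⟨s, -, hc, hs, hys⟩ := ih (σ.erase u) (Finset.erase_ssubset hu) y hy0
        (fun v hv => by
          by_cases hvu : v = u
          · rw [hvu, hyu]
          · exact hy' v fun h => hv (Finset.mem_erase.2 ⟨hvu, h⟩))
        (by
          rw [Finset.sum_erase _ hyu, Finset.sum_congr rfl hy, ← Finset.sum_div,
            Finset.sum_sub_distrib, hsum, Finset.sum_const, nsmul_eq_mul, ← hl, div_self hl1.ne'])
      refine ⟨insert σ s, Finset.insert_nonempty _ _, ?_, ?_, ?_⟩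
      · rw [Finset.coe_insert]
        exact hc.insert fun τ hτ _ =>
          Or.inr ((hs τ hτ).2.1.trans (Finset.erase_subset u σ))
      · intro τ hτ
        rcases Finset.mem_insert.1 hτ with rfl | hτ
        · exact ⟨hne, subset_rfl, hmax⟩
        · refine ⟨(hs τ hτ).1, (hs τ hτ).2.1.trans (Finset.erase_subset u σ), fun v hv => ?_⟩
          -- Subtracting a constant on `σ` and rescaling keeps the closest vertices closest.
          refine (hs τ hτ).2.2 v fun w => ?_
          by_cases hw : w ∈ σ
          · rw [hy v (hmax v hv), hy w hw]
            exact div_le_div_of_nonneg_right (sub_le_sub_right (hv w) _) hl1.le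
          · rw [hy' w hw]
            exact hy0 v
      · have hconv : Convex ℝ (geometricSimplex (insert σ s)) := convex_convexHull ℝ _
        have := hconv (barycenter_mem_geometricSimplex (Finset.mem_insert_self σ s))
          (geometricSimplex_mono (Finset.subset_insert σ s) hys)
          (mul_nonneg hpos.le (hx u)) hl1.le (by ring)
        convert this using 1
        ext v
        simp only [Pi.add_apply, Pi.smul_apply, smul_eq_mul]
        by_cases hv : v ∈ σ
        · rw [barycenter, Set.indicator_of_mem (Finset.mem_coe.2 hv), hy v hv,
            mul_div_cancel₀ _ hl1.ne']
          field_simp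
          ring
        · rw [barycenter, Set.indicator_of_notMem (by simpa using hv), hσ v hv, hy' v hv]
          simp

theorem exists_face_mem_geometricSimplex {K : PreAbstractSimplicialComplex V} {c : V → ι}
    {C : Finset ι} {x : V → ℝ} (hx : x ∈ K.colorClass c C) :
    ∃ s ∈ K.barycentricSubdivision.faces,
      geometricSimplex s ⊆ K.colorClass c C ∧ x ∈ geometricSimplex s := by
  obtain ⟨⟨h0, σ, hσ, hσ0, hsum⟩, hC⟩ := hx
  obtain ⟨s, hne, hc, hs, hxs⟩ := exists_chain_mem_geometricSimplex σ x h0 hσ0 hsum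
  have hsK : s ∈ K.barycentricSubdivision.faces :=
    ⟨hne, fun τ hτ => (K.isRelLowerSet_faces hσ).2 (hs τ hτ).2.1 (hs τ hτ).1, hc⟩
  refine ⟨s, hsK, (geometricSimplex_subset_colorClass_iff hsK).2 fun τ hτ => ?_, hxs⟩
  exact hC.trans (Set.image_mono fun v hv => (hs τ hτ).2.2 v hv)

/-- Convex sets are connected, so a simplex that meets a component lies in it. -/
theorem geometricSimplex_subset_connectedComponentIn {S : Set (V → ℝ)} {s : Finset (Finset V)}
    {x y : V → ℝ} (hs : geometricSimplex s ⊆ S) (hy : y ∈ geometricSimplex s)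
    (hyx : y ∈ connectedComponentIn S x) :
    geometricSimplex s ⊆ connectedComponentIn S x := by
  rw [connectedComponentIn_eq hyx]
  exact (convex_convexHull ℝ _).isPreconnected.subset_connectedComponentIn hy hs

theorem biUnion_geometricSimplex_subdivisionIn (K : PreAbstractSimplicialComplex V) (c : V → ι)
    (C : Finset ι) (x : V → ℝ) :
    ⋃ s ∈ (K.subdivisionIn (connectedComponentIn (K.colorClass c C) x)).faces,
      geometricSimplex s = connectedComponentIn (K.colorClass c C) x := by
  refine Set.Subset.antisymm (Set.iUnion₂_subset fun s hs => hs.2) fun y hy => ?_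
  obtain ⟨s, hs, hsC, hys⟩ :=
    exists_face_mem_geometricSimplex (connectedComponentIn_subset _ _ hy)
  exact Set.mem_biUnion (show s ∈ (K.subdivisionIn _).faces from
    ⟨hs, geometricSimplex_subset_connectedComponentIn hsC hys hy⟩) hys

theorem card_le_of_subset_image {c : V → ι} {C : Finset ι} {σ : Finset V}
    (h : (C : Set ι) ⊆ c '' σ) : C.card ≤ σ.card := by
  classical
  rw [← Finset.coe_image, Finset.coe_subset] at h
  exact (Finset.card_le_card h).trans Finset.card_image_le

theorem isPure_subdivisionIn {K : PreAbstractSimplicialComplex V} {d : ℕ} (hK : K.IsPure d)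
    (c : V → ι) (C : Finset ι) (hC : C.card ≤ d + 1) (hC0 : 1 ≤ C.card) (x : V → ℝ) :
    (K.subdivisionIn (connectedComponentIn (K.colorClass c C) x)).IsPure (d + 1 - C.card) := by
  classical
  rintro s ⟨hs, hsN⟩
  have hsC := (geometricSimplex_subset_colorClass_iff hs).1
    (hsN.trans (connectedComponentIn_subset _ _))
  constructor
  -- Members of a chain have distinct sizes.
  · have : s.card ≤ (Finset.Icc C.card (d + 1)).card := by
      refine Finset.card_le_card_of_injOn Finset.card (fun σ hσ => ?_)
        (injOn_card_of_isChain hs.2.2)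
      simpa using ⟨card_le_of_subset_image (hsC σ hσ), (hK σ (hs.2.1 σ hσ)).1⟩
    rw [Nat.card_Icc] at this
    omega
  · obtain ⟨μ, hμ, hmin⟩ := exists_subset_of_isChain hs.1 hs.2.2
    obtain ⟨ν, hν, hmax⟩ := exists_superset_of_isChain hs.1 hs.2.2
    obtain ⟨-, τ, hτ, hντ, hτc⟩ := hK ν (hs.2.1 ν hν)
    -- One vertex of each color in `C` is the smallest possible bottom; a maximal chain from it up
    -- to a facet stays in the component because it contains `s`.
    obtain ⟨ρ, hρμ, hρC, hρc⟩ : ∃ ρ ⊆ μ, (C : Set ι) ⊆ c '' ρ ∧ ρ.card = C.card := by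
      obtain ⟨ρ, hρμ, hinj, hρ⟩ := Finset.exists_subset_injOn_image_eq_of_surjOn _ _ (hsC μ hμ)
      refine ⟨ρ, hρμ, ?_, ?_⟩
      · rw [← hρ, Finset.coe_image]
      · rw [← hρ, Finset.card_image_of_injOn hinj]
    obtain ⟨t, hst, htc, ht, hcard⟩ := exists_maximal_chain_between
      ((hρμ.trans (hmax μ hμ)).trans hντ) hs.2.2
      fun σ hσ => ⟨hρμ.trans (hmin σ hσ), (hmax σ hσ).trans hντ⟩
    have hρne : ρ.Nonempty := Finset.card_pos.1 (by omega)
    have htK : t ∈ K.barycentricSubdivision.faces := ⟨hs.1.mono hst, fun σ hσ =>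
      (K.isRelLowerSet_faces hτ).2 (ht σ hσ).2 (hρne.mono (ht σ hσ).1), htc⟩
    refine ⟨t, ⟨htK, ?_⟩, hst, by omega⟩
    have hb := barycenter_mem_geometricSimplex hμ
    refine geometricSimplex_subset_connectedComponentIn
      ((geometricSimplex_subset_colorClass_iff htK).2 fun σ hσ => ?_)
      (geometricSimplex_mono hst hb) (hsN hb)
    exact hρC.trans (Set.image_mono (Finset.coe_subset.2 (ht σ hσ).1))

/-! ### Orienting the maximal chains -/

theorem eq_of_image_lt_eq {D q : ℕ} {e e' : Fin D ↪ V}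
    (h : e '' {a | (a : ℕ) < q} = e' '' {a | (a : ℕ) < q})
    (h' : e '' {a | (a : ℕ) < q + 1} = e' '' {a | (a : ℕ) < q + 1}) {a : Fin D}
    (ha : (a : ℕ) = q) : e' a = e a := by
  obtain ⟨b, hb, hba⟩ : e a ∈ e' '' {a | (a : ℕ) < q + 1} := h' ▸ ⟨a, by simp [ha], rfl⟩
  by_cases hbq : (b : ℕ) < q
  · obtain ⟨x, hx, hxa⟩ : e a ∈ e '' {a | (a : ℕ) < q} := h ▸ ⟨b, hbq, hba⟩
    rw [e.injective hxa] at hx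
    exact absurd ha hx.ne
  · have : b = a := Fin.ext (by simp only [Set.mem_ofPred_eq] at hb; omega)
    rw [← this, hba, this]

theorem eq_of_color_eq {D k : ℕ} {c : V → ι} {γ : ℕ → ι} (hγ : Set.InjOn γ (Set.Iio k))
    {e e' : Fin D ↪ V} (he : ∀ a : Fin D, (a : ℕ) < k → c (e a) = γ a)
    (he' : ∀ a : Fin D, (a : ℕ) < k → c (e' a) = γ a)
    (h : e '' {a | (a : ℕ) < k} = e' '' {a | (a : ℕ) < k}) {x : Fin D} (hx : (x : ℕ) < k) :
    e' x = e x := by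
  obtain ⟨y, hy, hyx⟩ : e' x ∈ e '' {a | (a : ℕ) < k} := h ▸ ⟨x, hx, rfl⟩
  have hcol : γ y = γ x := by rw [← he y hy, ← he' x hx, hyx]
  rw [← hyx, Fin.ext (hγ hy hx hcol)]

/-- By injectivity only the values at `a` and `b` are free, and they come from `{e a, e b}`. -/
theorem eq_swap_of_eq_off {D : ℕ} {e e' : Fin D ↪ V} {a b : Fin D}
    (hoff : ∀ x, x ≠ a → x ≠ b → e' x = e x) (hr : Set.range e' ⊆ Set.range e) (hne : e' ≠ e) :
    e' = (Equiv.swap a b).toEmbedding.trans e := by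
  have key : ∀ x, x = a ∨ x = b → e' x = e a ∨ e' x = e b := by
    intro x hx
    obtain ⟨y, hy⟩ := hr ⟨x, rfl⟩
    by_cases hya : y = a
    · exact Or.inl (hya ▸ hy.symm)
    by_cases hyb : y = b
    · exact Or.inr (hyb ▸ hy.symm)
    rw [← hoff y hya hyb] at hy
    have := e'.injective hy
    subst this
    tauto
  have hab : ¬ (e' a = e a ∧ e' b = e b) := by
    rintro ⟨ha, hb⟩
    refine hne (DFunLike.ext _ _ fun x => ?_)
    by_cases hxa : x = a
    · rw [hxa, ha]
    by_cases hxb : x = b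
    · rw [hxb, hb]
    exact hoff x hxa hxb
  have hinj : a ≠ b → e' a ≠ e' b := fun h h' => h (e'.injective h')
  ext x
  rw [Function.Embedding.trans_apply, Equiv.coe_toEmbedding]
  have ka := key a (Or.inl rfl)
  have kb := key b (Or.inr rfl)
  by_cases hxa : x = a
  · subst hxa
    rw [Equiv.swap_apply_left]
    grind
  by_cases hxb : x = b
  · subst hxb
    rw [Equiv.swap_apply_right]
    grind
  rw [Equiv.swap_apply_of_ne_of_ne hxa hxb, hoff x hxa hxb]

/-- Two orderings of vertices, such that the first `k` vertices have prescribed distinct colors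
and the initial segments of lengths `k, …, k + n` coincide except for one of length `k + p < k + n`,
agree except at (at most) two places. -/
theorem exists_eq_off_pair {D k n p : ℕ} (hD : D = k + n) (hp : p < n) {c : V → ι} {γ : ℕ → ι}
    (hγ : Set.InjOn γ (Set.Iio k)) {e e' : Fin D ↪ V}
    (he : ∀ a : Fin D, (a : ℕ) < k → c (e a) = γ a)
    (he' : ∀ a : Fin D, (a : ℕ) < k → c (e' a) = γ a)
    (h : ∀ m ≤ n, m ≠ p → e '' {a | (a : ℕ) < k + m} = e' '' {a | (a : ℕ) < k + m}) :
    ∃ a b : Fin D, ∀ x, x ≠ a → x ≠ b → e' x = e x := by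
  -- The vertex at place `a` is the difference of the segments of lengths `a` and `a + 1`.
  have hstep : ∀ a : Fin D, k ≤ a → (a : ℕ) ≠ k + p → (a : ℕ) + 1 ≠ k + p → e' a = e a := by
    intro a hka h₁ h₂
    have ha := a.isLt
    refine eq_of_image_lt_eq (q := k + (a - k)) (h _ (by omega) (by omega)) ?_ (by omega)
    have := h (a - k + 1) (by omega) (by omega)
    rwa [← add_assoc] at this
  rcases Nat.eq_zero_or_pos p with rfl | hp0
  · let z : Fin D := ⟨k, by omega⟩
    have h1 := h 1 (by omega) (by omega)
    -- `b` is where `e'` puts the first appended vertex of `e`. At the other places below `k`, both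
    -- orderings draw on the bottom vertices of `e`, which are determined by color.
    obtain ⟨b, hb, hbz⟩ : e z ∈ e' '' {a | (a : ℕ) < k + 1} := h1 ▸ ⟨z, by simp [z], rfl⟩
    simp only [Set.mem_ofPred_eq] at hb
    have hsmall : ∀ a : Fin D, (a : ℕ) < k → a ≠ b → e' a = e a := by
      intro a hak hab
      obtain ⟨x, hx, hxa⟩ : e' a ∈ e '' {a | (a : ℕ) < k + 1} :=
        h1 ▸ ⟨a, by simp only [Set.mem_ofPred_eq]; omega, rfl⟩
      simp only [Set.mem_ofPred_eq] at hx
      have hxz : x ≠ z := fun hxz => hab (e'.injective (by rw [← hxa, hbz, hxz]))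
      have hxk : (x : ℕ) < k := by
        have : (x : ℕ) ≠ k := fun h => hxz (Fin.ext h)
        omega
      have hcol : γ x = γ a := by rw [← he x hxk, ← he' a hak, hxa]
      rw [← hxa, Fin.ext (hγ hxk hak hcol)]
    refine ⟨z, b, fun x hxz hxb => ?_⟩
    by_cases hxk : (x : ℕ) < k
    · exact hsmall x hxk hxb
    · have : (x : ℕ) ≠ k := fun h => hxz (Fin.ext h)
      exact hstep x (by omega) (by omega) (by omega)
  · refine ⟨⟨k + p - 1, by omega⟩, ⟨k + p, by omega⟩, fun x hx₁ hx₂ => ?_⟩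
    by_cases hxk : (x : ℕ) < k
    · exact eq_of_color_eq hγ he he' (h 0 (by omega) (by omega)) hxk
    · have h₁ : (x : ℕ) ≠ k + p - 1 := fun h => hx₁ (Fin.ext h)
      have h₂ : (x : ℕ) ≠ k + p := fun h => hx₂ (Fin.ext h)
      exact hstep x (by omega) (by omega) (by omega)

/-- The `n + 1` distinct sizes fill `k, …, k + n`, so sorting by size is a permutation. -/
theorem exists_perm_card_eq {k n : ℕ} {v : Fin (n + 1) ↪ Finset V}
    (hc : IsChain (· ⊆ ·) (Set.range v)) (hv : ∀ j, k ≤ (v j).card ∧ (v j).card ≤ k + n) :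
    ∃ π : Equiv.Perm (Fin (n + 1)), ∀ j, (v j).card = k + π j := by
  let f : Fin (n + 1) → Fin (n + 1) := fun j =>
    ⟨(v j).card - k, by have := hv j; omega⟩
  have hf : Function.Injective f := by
    intro i j hij
    have hi := hv i
    have hj := hv j
    have hij : (v i).card - k = (v j).card - k := congrArg Fin.val hij
    exact v.injective (injOn_card_of_isChain hc ⟨i, rfl⟩ ⟨j, rfl⟩ (by omega))
  refine ⟨Equiv.ofBijective f (Finite.injective_iff_bijective.1 hf), fun j => ?_⟩
  have : ((f j : Fin (n + 1)) : ℕ) = (v j).card - k := rfl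
  rw [Equiv.ofBijective_apply, this]
  have := hv j
  omega

/-- The vertices of the top member of a maximal chain can be ordered such that all members are
initial segments and the vertices of the bottom member have prescribed colors. -/
theorem exists_ordering_of_maximal_chain {D k n : ℕ} (hD : D = k + n) {c : V → ι} {γ : ℕ → ι}
    (hγ : Set.InjOn γ (Set.Iio k)) {v : Fin (n + 1) ↪ Finset V}
    (hc : IsChain (· ⊆ ·) (Set.range v)) (hv : ∀ j, k ≤ (v j).card ∧ (v j).card ≤ k + n)
    (hcol : ∀ j, ∀ a < k, γ a ∈ c '' v j) :
    ∃ e : Fin D ↪ V, (∀ j, (v j : Set V) = e '' {a | (a : ℕ) < (v j).card}) ∧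
      ∀ a : Fin D, (a : ℕ) < k → c (e a) = γ a := by
  classical
  obtain ⟨π, hπ⟩ := exists_perm_card_eq hc hv
  let S : Fin (n + 1) → Finset V := fun m => v (π.symm m)
  have hS : ∀ m, (S m).card = k + m := fun m => by simp [S, hπ]
  have hmono : ∀ l m, l ≤ m → S l ⊆ S m := by
    intro l m hlm
    have h₁ := hS l
    have h₂ := hS m
    have hlm : (l : ℕ) ≤ m := hlm
    rcases hc.total ⟨π.symm l, rfl⟩ ⟨π.symm m, rfl⟩ with h | h
    · exact h
    · exact (Finset.eq_of_subset_of_card_le h (show (S l).card ≤ (S m).card by omega)).ge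
  -- Below `k`, take a bottom vertex of color `γ a`; from `k` on, a vertex of `S (a - k + 1)`
  -- outside `S (a - k)`.
  have hex : ∀ a : Fin D, ∃ x, (∀ m : Fin (n + 1), (a : ℕ) < k + m → x ∈ S m) ∧
      (∀ m : Fin (n + 1), k + m ≤ a → x ∉ S m) ∧ ((a : ℕ) < k → c x = γ a) := by
    intro a
    have ha := a.isLt
    by_cases hak : (a : ℕ) < k
    · obtain ⟨x, hx, hxa⟩ := hcol (π.symm 0) a hak
      exact ⟨x, fun m _ => hmono 0 m (Fin.zero_le m) hx, fun m hm => by omega, fun _ => hxa⟩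
    · let l : Fin (n + 1) := ⟨a - k, by omega⟩
      let m : Fin (n + 1) := ⟨a - k + 1, by omega⟩
      have hl : (l : ℕ) = a - k := rfl
      have hm : (m : ℕ) = a - k + 1 := rfl
      obtain ⟨x, hxm, hxl⟩ := Finset.exists_mem_notMem_of_card_lt_card
        (s := S l) (t := S m) (by rw [hS, hS]; omega)
      refine ⟨x, fun i hi => hmono m i (Fin.le_def.2 (by omega)) hxm, fun i hi hxi => ?_,
        fun h => absurd h hak⟩
      exact hxl (hmono i l (Fin.le_def.2 (by omega)) hxi)
  choose f hf₁ hf₂ hf₃ using hex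
  have hlt : ∀ a b, a < b → f a ≠ f b := by
    intro a b hab h
    have hab' : (a : ℕ) < b := hab
    have hb := b.isLt
    by_cases hbk : (b : ℕ) < k
    · have := hγ (show (a : ℕ) < k by omega) hbk
        (by rw [← hf₃ a (by omega), ← hf₃ b hbk, h])
      omega
    · let l : Fin (n + 1) := ⟨b - k, by omega⟩
      have hl : (l : ℕ) = b - k := rfl
      exact hf₂ b l (by omega) (h ▸ hf₁ a l (by omega))
  have hinj : Function.Injective f := fun a b h => by
    by_contra hab
    rcases lt_or_gt_of_ne hab with hab | hab
    · exact hlt a b hab h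
    · exact hlt b a hab h.symm
  refine ⟨⟨f, hinj⟩, fun j => ?_, hf₃⟩
  have hsub : (Finset.univ.filter fun a : Fin D => (a : ℕ) < (v j).card).image f ⊆ v j := by
    intro x hx
    obtain ⟨a, ha, rfl⟩ := Finset.mem_image.1 hx
    have := hf₁ a (π j) (by rw [← hπ]; exact (Finset.mem_filter.1 ha).2)
    simpa [S] using this
  have hle : (v j).card ≤ D := hD ▸ (hv j).2
  have hcard : (Finset.univ.filter fun a : Fin D => (a : ℕ) < (v j).card).card = (v j).card := by
    rw [Fin.card_filter_val_lt, min_eq_right hle]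
  have := Finset.eq_of_subset_of_card_le hsub (by rw [Finset.card_image_of_injective _ hinj, hcard])
  conv_lhs => rw [← this]
  ext x
  simp

theorem map_mem_faces_of_image_lt {M : PreAbstractSimplicialComplex V} {D : ℕ} {e : Fin D ↪ V}
    {σ : Finset V} (hσ : σ ∈ M.faces) (h : (σ : Set V) = e '' {a | (a : ℕ) < σ.card})
    (hc : σ.card = D) : Finset.univ.map e ∈ M.faces := by
  have : Finset.univ.map e = σ := by
    rw [← Finset.coe_inj, h, hc]
    simp
  rwa [this]

/-- A complex of chains of faces of an orientable complex is orientable if the chains consist of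
faces with at least `k` vertices, including vertices of `k` prescribed colors: order the bottom face
of a maximal chain by color, append the remaining vertices one at a time, and use the sign of the
resulting ordered facet. -/
theorem IsOrientable.chains {M : PreAbstractSimplicialComplex V} {d k n : ℕ}
    (hM : M.IsOrientable d) (hd : d + 1 = k + n) (hk : 1 ≤ k) {c : V → ι} {γ : ℕ → ι}
    (hγ : Set.InjOn γ (Set.Iio k)) (K : PreAbstractSimplicialComplex (Finset V))
    (hc : ∀ s ∈ K.faces, IsChain (· ⊆ ·) (s : Set (Finset V)))
    (hK : ∀ s ∈ K.faces, ∀ σ ∈ s, σ ∈ M.faces ∧ k ≤ σ.card ∧ σ.card ≤ d + 1 ∧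
      ∀ a < k, γ a ∈ c '' σ) :
    K.IsOrientable n := by
  classical
  obtain ⟨o, ho₁, ho₂⟩ := hM
  have hchain : ∀ v : Fin (n + 1) ↪ Finset V, Finset.univ.map v ∈ K.faces →
      IsChain (· ⊆ ·) (Set.range v) := fun v hv => by simpa using hc _ hv
  have hface : ∀ v : Fin (n + 1) ↪ Finset V, Finset.univ.map v ∈ K.faces → ∀ j, v j ∈ M.faces ∧
      k ≤ (v j).card ∧ (v j).card ≤ d + 1 ∧ ∀ a < k, γ a ∈ c '' v j :=
    fun v hv j => hK _ hv _ (by simp)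
  -- The sign `z` belongs to the unordered chain; the order of its members will enter only through
  -- the sign of the permutation `P v` that sorts them by size. The value `1` is a default where
  -- there is no maximal chain.
  have hE : ∀ s : Finset (Finset V), ∃ z : ℤˣ, s ∈ K.faces → s.card = n + 1 →
      ∃ e : Fin (d + 1) ↪ V, (∀ σ ∈ s, (σ : Set V) = e '' {a | (a : ℕ) < σ.card}) ∧
        (∀ a : Fin (d + 1), (a : ℕ) < k → c (e a) = γ a) ∧ z = o e := by
    intro s
    by_cases hs : s ∈ K.faces ∧ s.card = n + 1
    · let v : Fin (n + 1) ↪ Finset V :=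
        (s.equivFinOfCardEq hs.2).symm.toEmbedding.trans (Function.Embedding.subtype _)
      have hvs : Finset.univ.map v = s := by
        rw [← Finset.map_map, Finset.map_univ_equiv, Finset.univ_eq_attach,
          Finset.attach_map_val]
      have hv : Finset.univ.map v ∈ K.faces := hvs.symm ▸ hs.1
      obtain ⟨e, he, hec⟩ := exists_ordering_of_maximal_chain hd hγ (hchain v hv)
        (fun j => ⟨(hface v hv j).2.1, hd ▸ (hface v hv j).2.2.1⟩)
        (fun j => (hface v hv j).2.2.2)
      refine ⟨o e, fun _ _ => ⟨e, fun σ hσ => ?_, hec, rfl⟩⟩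
      rw [← hvs] at hσ
      obtain ⟨j, -, rfl⟩ := Finset.mem_map.1 hσ
      exact he j
    · exact ⟨1, fun h h' => absurd ⟨h, h'⟩ hs⟩
  have hP : ∀ v : Fin (n + 1) ↪ Finset V, ∃ π : Equiv.Perm (Fin (n + 1)),
      Finset.univ.map v ∈ K.faces → ∀ j, (v j).card = k + π j := by
    intro v
    by_cases hv : Finset.univ.map v ∈ K.faces
    · obtain ⟨π, hπ⟩ := exists_perm_card_eq (k := k) (hchain v hv) fun j =>
        ⟨(hface v hv j).2.1, hd ▸ (hface v hv j).2.2.1⟩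
      exact ⟨π, fun _ => hπ⟩
    · exact ⟨1, fun h => absurd h hv⟩
  choose E hE using hE
  choose P hP using hP
  refine ⟨fun v => Equiv.Perm.sign (P v) * E (Finset.univ.map v), fun v hv ρ => ?_,
    fun hn v w hv hw i hi hvw => ?_⟩
  · have hmap : Finset.univ.map (ρ.toEmbedding.trans v) = Finset.univ.map v := by
      rw [← Finset.map_map, Finset.map_univ_equiv]
    have hPρ : P (ρ.toEmbedding.trans v) = P v * ρ := by
      ext j
      have h₁ := hP (ρ.toEmbedding.trans v) (hmap ▸ hv) j
      have h₂ := hP v hv (ρ j)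
      simp only [Function.Embedding.trans_apply, Equiv.coe_toEmbedding] at h₁
      rw [Equiv.Perm.mul_apply]
      omega
    dsimp only
    rw [hmap, hPρ, map_mul, mul_comm (Equiv.Perm.sign (P v)), mul_assoc]
  · have hPv := hP v hv
    have hPw := hP w hw
    have hoff : ∀ j, j ≠ i → P w j = P v j := by
      intro j hj
      have h₁ := hPv j
      have h₂ := hPw j
      rw [← hvw j hj] at h₂
      exact Fin.ext (by omega)
    -- All other sizes agree, so the members exchanged have the same size too.
    have hPeq : P w = P v := by
      have hi : P w i = P v i := by
        obtain ⟨j, hj⟩ := (P w).surjective (P v i)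
        by_cases hji : j = i
        · rw [← hji, hj, hji]
        · exact absurd ((P v).injective ((hoff j hji).symm.trans hj)) hji
      ext j
      by_cases hj : j = i
      · rw [hj, hi]
      · rw [hoff j hj]
    obtain ⟨e, hev, hcv, hzv⟩ := hE _ hv (by simp)
    obtain ⟨e', hew, hcw, hzw⟩ := hE _ hw (by simp)
    have hev' : ∀ j, (v j : Set V) = e '' {a | (a : ℕ) < k + P v j} := fun j => by
      rw [← hPv]; exact hev _ (by simp)
    have hew' : ∀ j, (w j : Set V) = e' '' {a | (a : ℕ) < k + P v j} := fun j => by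
      rw [← hPeq, ← hPw]; exact hew _ (by simp)
    have hne : e' ≠ e := fun h => hi (Finset.coe_injective (by rw [hev', hew', h]))
    have hseg : ∀ m ≤ n, m ≠ P v i →
        e '' {a | (a : ℕ) < k + m} = e' '' {a | (a : ℕ) < k + m} := by
      intro m hm hmi
      have hj : P v ((P v).symm ⟨m, by omega⟩) = ⟨m, by omega⟩ := Equiv.apply_symm_apply _ _
      have hji : (P v).symm ⟨m, by omega⟩ ≠ i := fun h => hmi (by rw [← h, hj])
      have h₁ := hev' ((P v).symm ⟨m, by omega⟩)
      have h₂ := hew' ((P v).symm ⟨m, by omega⟩)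
      rw [hj] at h₁ h₂
      rw [← h₁, ← h₂, hvw _ hji]
    have hlast : ∀ j, P v j = Fin.last n → (v j).card = d + 1 ∧ (w j).card = d + 1 := by
      intro j hj
      rw [hPv, hPw, hPeq, hj, hd]
      simp
    have hev_face : Finset.univ.map e ∈ M.faces := by
      have hj : P v ((P v).symm (Fin.last n)) = Fin.last n := Equiv.apply_symm_apply _ _
      exact map_mem_faces_of_image_lt (hface v hv _).1 (hev _ (by simp)) (hlast _ hj).1
    have hew_face : Finset.univ.map e' ∈ M.faces := by
      have hj : P v ((P v).symm (Fin.last n)) = Fin.last n := Equiv.apply_symm_apply _ _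
      exact map_mem_faces_of_image_lt (hface w hw _).1 (hew _ (by simp)) (hlast _ hj).2
    suffices o e' = - o e by
      dsimp only
      rw [hPeq, hzv, hzw, this, mul_neg]
    -- If the top member is kept, both orderings are of the same facet of `M` and differ by a
    -- transposition.
    by_cases hp : (P v i : ℕ) < n
    · obtain ⟨a, b, hab⟩ := exists_eq_off_pair hd hp hγ hcv hcw hseg
      have huniv : {a : Fin (d + 1) | (a : ℕ) < k + n} = Set.univ :=
        Set.eq_univ_of_forall fun a => hd ▸ a.isLt
      have hr := hseg n le_rfl hp.ne'
      rw [huniv, Set.image_univ, Set.image_univ] at hr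
      have hswap := eq_swap_of_eq_off hab hr.ge hne
      have hane : a ≠ b := by
        rintro rfl
        refine hne (hswap.trans ?_)
        ext x
        simp
      rw [hswap, ho₁ e hev_face, Equiv.Perm.sign_swap hane, neg_one_mul]
    -- If the top member changes, all segments of lengths `k, …, d` agree, so only the last vertex
    -- differs. Here `0 < d`, since `k ≥ 1` and `n > 0`.
    · have hoff : ∀ x, x ≠ Fin.last d → e x = e' x := by
        intro x hx
        have hxd : (x : ℕ) ≠ d := fun h => hx (Fin.ext h)
        symm
        by_cases hxk : (x : ℕ) < k
        · exact eq_of_color_eq hγ hcv hcw (hseg 0 (by omega) (by omega)) hxk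
        · refine eq_of_image_lt_eq (q := k + (x - k)) (hseg _ (by omega) (by omega)) ?_ (by omega)
          have := hseg (x - k + 1) (by omega) (by omega)
          rwa [← add_assoc] at this
      refine ho₂ (by omega) e e' hev_face hew_face (Fin.last d) (fun h => hne ?_) hoff
      ext x
      by_cases hx : x = Fin.last d
      · rw [hx, h]
      · rw [hoff x hx]

end PreAbstractSimplicialComplex

theorem proposition3p5 {V ι : Type*} (d k : ℕ) (hk : 1 ≤ k) (hkd : k ≤ d + 1)
    (M : PreAbstractSimplicialComplex V) (hM : M.IsCombinatorialManifold d)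
    (hor : M.IsOrientable d) (c : V → ι) (C : Finset ι) (hC : C.card = k)
    (N : Set (V → ℝ))
    (hN : ∃ x ∈ M.colorClass c C, N = connectedComponentIn (M.colorClass c C) x) :
    (⋃ s ∈ (M.subdivisionIn N).faces, PreAbstractSimplicialComplex.geometricSimplex s) = N ∧
      (M.subdivisionIn N).IsPure (d + 1 - k) ∧
      (M.subdivisionIn N).IsOrientable (d + 1 - k) := by
  subst hC
  obtain ⟨x, -, rfl⟩ := hN
  refine ⟨M.biUnion_geometricSimplex_subdivisionIn c C x,
    PreAbstractSimplicialComplex.isPure_subdivisionIn hM.isPure c C hkd hk x, ?_⟩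
  have : Nonempty ι := (Finset.card_pos.1 hk).to_type
  -- An arbitrary enumeration of `C` fixes the order of the colors once for all chains.
  obtain ⟨γ, hγ⟩ := (Set.finite_Iio C.card).exists_bijOn_of_encard_eq
    (t := (C : Set ι)) (by
      rw [← Finset.coe_Iio, Set.encard_coe_eq_coe_finsetCard, Nat.card_Iio,
        Set.encard_coe_eq_coe_finsetCard])
  refine hor.chains (Nat.add_sub_cancel' hkd).symm hk hγ.injOn (c := c) _ (fun s hs => hs.1.2.2)
    fun s hs σ hσ => ?_
  have hsC := (PreAbstractSimplicialComplex.geometricSimplex_subset_colorClass_iff hs.1).1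
    (hs.2.trans (connectedComponentIn_subset _ _)) σ hσ
  have hσM := hs.1.2.1 σ hσ
  exact ⟨hσM, PreAbstractSimplicialComplex.card_le_of_subset_image hsC, (hM.isPure σ hσM).1,
    fun a ha => hsC (hγ.mapsTo ha)⟩
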